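/- A finite sequence $s$ \emph{contains} a finite sequence $u$ if some (not necessarily contiguous) subsequence of $s$ is isomorphic to $u$, i.e. is obtained from $u$ by an injective renaming of the letters; otherwise $s$ \emph{avoids} $u$. If $u$ has exactly $r$ distinct letters, let $\mathrm{Ex}(u,n)$ denote the maximum possible length of a sequence on at most $n$ distinct letters that avoids $u$ and in which every $r$ consecutive letters are pairwise distinct (put $\mathrm{Ex}(u,n)=0$ if $u$ is the empty sequence). The sequence $u$ is called \emph{minimally non-linear} if $\mathrm{Ex}(u,n)=\omega(n)$ as $n\to\infty$, but $\mathrm{Ex}(v,n)=O(n)$ for every sequence $v$ that is strictly contained in $u$ (contained in $u$ and not isomorphic to $u$). Lemma. Let $u$ be a minimally non-linear sequence with exactly $k$ distinct letters. Then the length of $u$ is at most $2\,\mathrm{Ex}(ababa,k)$. Moreover, $u$ has no three consecutive equal letters, and if $u$ is not isomorphic to $ababa$, then $u$ avoids $ababa$. -/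

import Mathlib

open Asymptotics Filter

namespace DSSeq

/-- Two finite sequences are isomorphic if one is obtained from the other by an injective
renaming of the letters: they have the same length, and two positions carry equal letters in one
exactly when they do in the other. -/
def Iso {α β : Type*} (v : List α) (w : List β) : Prop :=
  v.length = w.length ∧ ∀ i j : ℕ, v[i]? = v[j]? ↔ w[i]? = w[j]?

/-- `s` contains `u` if some (not necessarily contiguous) subsequence of `s` is isomorphic
to `u`. -/
def Contains {α β : Type*} (s : List α) (u : List β) : Prop :=
  ∃ w : List α, w.Sublist s ∧ Iso w u

/-- `s` avoids `u` if `s` does not contain `u`. -/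
def Avoids {α β : Type*} (s : List α) (u : List β) : Prop :=
  ¬ Contains s u

/-- The number of distinct letters of a sequence. -/
def numLetters {α : Type*} [DecidableEq α] (u : List α) : ℕ :=
  u.toFinset.card

/-- Every `r` consecutive letters of `s` are pairwise distinct. -/
def Sparse {α : Type*} (r : ℕ) (s : List α) : Prop :=
  ∀ w : List α, w <:+: s → w.length = r → w.Nodup

/-- The lengths of the sequences on (at most) `n` distinct letters that avoid `u` and in which
every `r` consecutive letters are distinct, `r` being the number of distinct letters of `u`. -/
def exLengths {α : Type*} [DecidableEq α] (u : List α) (n : ℕ) : Set ℕ :=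
  {l | ∃ s : List ℕ, s.length = l ∧ numLetters s ≤ n ∧ Sparse (numLetters u) s ∧ Avoids s u}

/-- The extremal function `Ex(u, n)`: the maximum of `exLengths u n`, see `isGreatest_Ex`
(and `0` if `u` is the empty sequence, which no sequence avoids). -/
noncomputable def Ex {α : Type*} [DecidableEq α] (u : List α) (n : ℕ) : ℕ :=
  sSup (exLengths u n)

/-- The set whose maximum is `Ex(u, n)` is bounded. -/
theorem bddAbove_exLengths {α : Type*} [DecidableEq α] (u : List α) (n : ℕ) :
    BddAbove (exLengths u n) := by
  classical
  set r := numLetters u with hr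
  refine ⟨r + r * (n ^ r * u.length), ?_⟩
  rintro l ⟨s, rfl, hn, hsp, hav⟩
  by_contra! hlt
  apply hav
  rcases u.eq_nil_or_concat with hu | ⟨u', a₀, hu'⟩
  · exact ⟨[], List.nil_sublist s, by subst hu; exact ⟨rfl, fun i j => by simp⟩⟩
  have hne : u ≠ [] := by rw [hu']; simp
  have hrpos : 0 < r := by
    rw [hr, numLetters, Finset.card_pos]
    exact (List.toFinset_nonempty_iff u).mpr hne
  -- split the beginning of `s` into `m + 1` blocks of length `r`
  set m := n ^ r * u.length with hm
  have hpos : ∀ (i : ℕ) (c : Fin r), i ≤ m → i * r + c < s.length := by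
    intro i c hi
    have h1 : i * r ≤ m * r := Nat.mul_le_mul_right r hi
    have h2 := c.2
    have h3 : r * m = m * r := Nat.mul_comm r m
    omega
  let f : ℕ → Fin r → ℕ := fun i c => s.getD (i * r + c) 0
  have hf : ∀ (i : ℕ) (c : Fin r) (hi : i ≤ m), f i c = s[i * r + c]'(hpos i c hi) := by
    intro i c hi
    simp [f, List.getD_eq_getElem?_getD, List.getElem?_eq_getElem (hpos i c hi)]
  have hmaps : ∀ i ∈ Finset.range (m + 1), f i ∈ Fintype.piFinset fun _ : Fin r => s.toFinset := by
    intro i hi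
    rw [Fintype.mem_piFinset]
    intro c
    rw [hf i c (Nat.lt_succ_iff.mp (Finset.mem_range.mp hi))]
    simp
  have hcard : (Fintype.piFinset fun _ : Fin r => s.toFinset).card * u.length
      < (Finset.range (m + 1)).card := by
    rw [Fintype.card_piFinset, Finset.card_range]
    simp only [Finset.prod_const, Finset.card_univ, Fintype.card_fin]
    have : s.toFinset.card ^ r ≤ n ^ r := Nat.pow_le_pow_left hn r
    exact Nat.lt_succ_of_le (Nat.mul_le_mul_right _ this)
  obtain ⟨b, -, hb⟩ := Finset.exists_lt_card_fiber_of_mul_lt_card_of_maps_to hmaps hcard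
  -- `b` is a block of distinct letters
  set I := (Finset.range (m + 1)).filter fun i => f i = b with hI
  obtain ⟨J, hJI, hJ⟩ := Finset.exists_subset_card_eq hb.le
  let e : Fin u.length ↪o ℕ := J.orderEmbOfFin hJ
  have he : ∀ i, e i ≤ m ∧ f (e i) = b := by
    intro i
    have h := hJI (J.orderEmbOfFin_mem hJ i)
    rw [hI, Finset.mem_filter, Finset.mem_range] at h
    exact ⟨Nat.lt_succ_iff.mp h.1, h.2⟩
  have hinj : Function.Injective b := by
    have hlen : 0 < u.length := List.length_pos_iff.mpr hne
    obtain ⟨h1, h2⟩ := he ⟨0, hlen⟩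
    set i₀ := e ⟨0, hlen⟩
    have hl : ((s.drop (i₀ * r)).take r).length = r := by
      have := hpos i₀ ⟨r - 1, by omega⟩ h1
      simp only [List.length_take, List.length_drop] at *
      omega
    have hnd := hsp ((s.drop (i₀ * r)).take r)
      ((List.take_prefix _ _).isInfix.trans (List.drop_suffix _ _).isInfix) hl
    intro c d hcd
    rw [← h2, hf i₀ c h1, hf i₀ d h1] at hcd
    have := (hnd.getElem_inj_iff (i := c) (hi := by omega) (j := d) (hj := by omega)).mp
      (by simpa using hcd)
    exact Fin.ext this
  -- number the letters of `u`
  let g : u.toFinset ≃ Fin r := u.toFinset.equivFin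
  let c : Fin u.length → Fin r := fun i => g ⟨u[i], by simp⟩
  have hc : ∀ i j, c i = c j ↔ u[i] = u[j] := by
    intro i j
    simp [c]
  have hmono : StrictMono fun i : Fin u.length =>
      (⟨e i * r + c i, hpos _ _ (he i).1⟩ : Fin s.length) := by
    intro i j hij
    have h1 : e i + 1 ≤ e j := e.strictMono hij
    have h2 : (e i + 1) * r ≤ e j * r := Nat.mul_le_mul_right r h1
    have h3 := (c i).2
    rw [Nat.add_mul] at h2
    show e i * r + (c i : ℕ) < e j * r + (c j : ℕ)
    omega
  refine ⟨List.ofFn fun i : Fin u.length => b (c i), ?_, by simp, ?_⟩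
  · rw [List.sublist_iff_exists_fin_orderEmbedding_get_eq]
    refine ⟨(Fin.castOrderIso (by simp)).toOrderEmbedding.trans
      (OrderEmbedding.ofStrictMono _ hmono), ?_⟩
    intro i
    have hi : (i : ℕ) < u.length := by simpa using i.2
    have h1 := he ⟨i, hi⟩
    have h2 := hf (e ⟨i, hi⟩) (c ⟨i, hi⟩) h1.1
    have h3 := (congrFun h1.2 (c ⟨i, hi⟩)).symm.trans h2
    simp only [List.get_ofFn]
    exact h3
  · intro i j
    simp only [List.getElem?_ofFn]
    by_cases hi : i < u.length <;> by_cases hj : j < u.length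
    · simpa [hi, hj, hinj.eq_iff] using hc ⟨i, hi⟩ ⟨j, hj⟩
    · simp [hi, hj]
    · simp [hi, hj]
    · simp [hi, hj]

/-- `Ex(u, n)` is indeed a maximum, unless `u` is empty. -/
theorem isGreatest_Ex {α : Type*} [DecidableEq α] (u : List α) (hu : u ≠ []) (n : ℕ) :
    IsGreatest (exLengths u n) (Ex u n) := by
  refine ⟨Nat.sSup_mem ⟨0, [], rfl, by simp [numLetters], ?_, ?_⟩ (bddAbove_exLengths u n),
    fun l hl => le_csSup (bddAbove_exLengths u n) hl⟩
  · intro w hw _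
    simp [List.infix_nil.mp hw]
  · rintro ⟨w, hw, hl, -⟩
    rw [List.sublist_nil.mp hw] at hl
    exact hu (List.length_eq_zero_iff.mp hl.symm)

/-- `u` is minimally non-linear if `Ex(u, n) = ω(n)`, but `Ex(v, n) = O(n)` for every sequence `v`
strictly contained in `u`, that is, contained in `u` and not isomorphic to `u`. -/
def MinimallyNonlinear {α : Type*} [DecidableEq α] (u : List α) : Prop :=
  ((fun n : ℕ => (n : ℝ)) =o[atTop] fun n : ℕ => (Ex u n : ℝ)) ∧
    ∀ v : List α, Contains u v → ¬ Iso v u →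
      (fun n : ℕ => (Ex v n : ℝ)) =O[atTop] fun n : ℕ => (n : ℝ)

/-- The sequence `ababa`, with `a = 0` and `b = 1`. -/
def ababa : List ℕ := [0, 1, 0, 1, 0]

end DSSeq

namespace DSSeq

/-! Two estimates for the extremal function carry the theorem.

Tripling a doubled letter costs only a constant factor and an additive constant (`Ex_triple_le`). If
`u` had three consecutive letters `a`, deleting one of them would give a strictly contained sequence
with linear extremal function, and then that of `u` would be linear as well. For the estimate, a
long sequence is cut into blocks of a constant length, each with at least `r` letters. One letter
per block is either kept or spent as a separator between kept letters, so that a doubled letter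
among the kept ones is a tripled letter in the original sequence.

`Ex(ababa, n)` is not `O(n)` (`not_isBigO_Ex_ababa`), so a minimally non-linear sequence cannot
strictly contain `ababa`. The lower bound is a recursive construction of sequences cut into blocks,
some of them special and consisting of new letters. In `Blocks.combine Z W`, each special block `A`
of `W` becomes a fresh copy of `Z` with one letter of `A` appended to each special block, followed
by the reversal of `A`. The invariant that survives the recursion is that there is no alternation of
length five even after every special block is followed by its reversal (`Blocks.dbl`).

For the length bound, keeping one letter from each adjacent equal pair leaves at least half of a
sequence without triples. If `u` avoids `ababa`, what is left has at most `Ex(ababa, k)` letters; if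
`u` is isomorphic to `ababa`, the bound follows from `5 ≤ 2 * 3`. -/

theorem Iso.symm {α β : Type*} {v : List α} {w : List β} (h : Iso v w) : Iso w v :=
  ⟨h.1.symm, fun i j => (h.2 i j).symm⟩

theorem Iso.trans {α β γ : Type*} {v : List α} {w : List β} {x : List γ}
    (h : Iso v w) (h' : Iso w x) : Iso v x :=
  ⟨h.1.trans h'.1, fun i j => (h.2 i j).trans (h'.2 i j)⟩

theorem Contains.of_sublist {α β : Type*} {s t : List α} {u : List β} (h : Contains s u)
    (hst : s.Sublist t) : Contains t u := by
  obtain ⟨w, hw, hi⟩ := h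
  exact ⟨w, hw.trans hst, hi⟩

theorem numLetters_le_of_sublist {α : Type*} [DecidableEq α] {s t : List α} (h : s.Sublist t) :
    numLetters s ≤ numLetters t :=
  Finset.card_le_card fun x hx => by
    rw [List.mem_toFinset] at *
    exact h.subset hx

/-! ### Tripling a doubled letter -/

theorem getElem?_triple {α : Type*} (x y : List α) (a : α) (i : ℕ) :
    (x ++ [a, a, a] ++ y)[i]? = (x ++ [a, a] ++ y)[if i ≤ x.length + 1 then i else i - 1]? := by
  rcases lt_trichotomy i (x.length + 1) with h | h | h
  · rw [if_pos h.le]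
    rcases Nat.lt_succ_iff_lt_or_eq.mp h with h | rfl
    · simp [List.getElem?_append_left h]
    · simp
  · subst h
    simp
  · rw [if_neg (by omega)]
    obtain ⟨k, rfl⟩ : ∃ k, i = x.length + (k + 2) := ⟨i - x.length - 2, by omega⟩
    have h2 : x.length + (k + 2) - 1 = x.length + (k + 1) := by omega
    rw [h2, List.append_assoc, List.append_assoc,
      List.getElem?_append_right (l₁ := x) (Nat.le_add_right _ _),
      List.getElem?_append_right (l₁ := x) (Nat.le_add_right _ _)]
    simp

/-- By `getElem?_triple`, the tripled sequence is read off from the doubled one through an index map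
that depends only on the length of the prefix, so the pattern of equalities carries over. -/
theorem Iso.triple {α β : Type*} {x y : List α} {x' y' : List β} {a : α} {b : β}
    (hx : x'.length = x.length) (h : Iso (x' ++ [b, b] ++ y') (x ++ [a, a] ++ y)) :
    Iso (x' ++ [b, b, b] ++ y') (x ++ [a, a, a] ++ y) := by
  refine ⟨?_, fun i j => ?_⟩
  · have := h.1
    simp only [List.length_append, List.length_cons, List.length_nil] at *
    omega
  · simp only [getElem?_triple, hx]
    exact h.2 _ _

/-- A sequence isomorphic to `x a a y` has two equal letters at the same place. -/
theorem Iso.exists_pair {α β : Type*} {x y : List α} {a : α} {z : List β}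
    (h : Iso z (x ++ [a, a] ++ y)) :
    ∃ x' b y', x'.length = x.length ∧ z = x' ++ [b, b] ++ y' := by
  have hl := h.1
  simp only [List.length_append, List.length_cons, List.length_nil] at hl
  have h1 := (h.2 x.length (x.length + 1)).mpr (by simp)
  rw [List.getElem?_eq_getElem (by omega), List.getElem?_eq_getElem (by omega),
    Option.some_inj] at h1
  refine ⟨z.take x.length, z[x.length], z.drop (x.length + 2), by
    rw [List.length_take]; omega, ?_⟩
  conv_lhs => rw [← List.take_append_drop x.length z]
  rw [List.drop_eq_getElem_cons (by omega), List.drop_eq_getElem_cons (by omega), ← h1]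
  simp

theorem sublist_append_singleton_iff {α : Type*} {l s : List α} {c : α} :
    l.Sublist (s ++ [c]) ↔ l.Sublist s ∨ ∃ l', l = l' ++ [c] ∧ l'.Sublist s := by
  constructor
  · intro h
    obtain ⟨l₁, l₂, rfl, h1, h2⟩ := List.sublist_append_iff.mp h
    rcases List.sublist_singleton.mp h2 with rfl | rfl
    · left; simpa using h1
    · right; exact ⟨l₁, rfl, h1⟩
  · rintro (h | ⟨l', rfl, h⟩)
    · exact h.trans (List.sublist_append_left _ _)
    · exact h.append (List.Sublist.refl _)

/-- A sequence all of whose `L`-blocks have at least `r` letters has an `r`-sparse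
subsequence of proportional length in which any two neighbouring occurrences of a letter are
separated by another occurrence of it in the whole sequence. -/
theorem exists_separated_aux {r L : ℕ} (hr : 0 < r) (s : List ℕ)
    (hs : ∀ I, I <:+: s → I.length = L → r ≤ I.toFinset.card) (j : ℕ) (hj : j * L ≤ s.length) :
    ∃ (w : List ℕ) (B : Finset ℕ), w.Sublist (s.take (j * L)) ∧
      (∀ x, x <:+: w → x.length ≤ r → x.Nodup) ∧
      (∀ x a y, (x ++ [a, a] ++ y).Sublist w → (x ++ [a, a, a] ++ y).Sublist (s.take (j * L))) ∧
      (∀ c, c ∉ B → ∀ x, (x ++ [c]).Sublist w → (x ++ [c, c]).Sublist (s.take (j * L))) ∧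
      B.card + j ≤ 2 * w.length := by
  induction j with
  | zero =>
    refine ⟨[], ∅, by simp, ?_, ?_, ?_, by simp⟩
    · intro x hx _
      simp [List.infix_nil.mp hx]
    · intro x a y h; simp at h
    · intro c _ x h; simp at h
  | succ j ih =>
    have hj' : j * L + L ≤ s.length := by rwa [Nat.succ_mul] at hj
    obtain ⟨w, B, hw, hsp, hQ, hR, hcard⟩ := ih (by omega)
    set s' := s.take (j * L) with hs'
    set I := (s.drop (j * L)).take L with hI
    have hsI : s.take ((j + 1) * L) = s' ++ I := by rw [Nat.succ_mul, List.take_add]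
    rw [hsI]
    have hIr : r ≤ I.toFinset.card := by
      apply hs
      · exact (List.take_prefix _ _).isInfix.trans (List.drop_suffix _ _).isInfix
      · simp only [hI, List.length_take, List.length_drop]; omega
    have hlast : (w.drop (w.length - (r - 1))).toFinset.card < I.toFinset.card := by
      have := List.toFinset_card_le (w.drop (w.length - (r - 1)))
      rw [List.length_drop] at this
      omega
    -- The new block has more letters than the last `r - 1` places of `w`, so some letter `c` can be
    -- appended without losing `r`-sparsity.
    obtain ⟨c, hcI, hcw⟩ := Finset.exists_mem_notMem_of_card_lt_card hlast
    rw [List.mem_toFinset] at hcI hcw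
    have hcI' : [c].Sublist I := List.singleton_sublist.mpr hcI
    have hss : s'.Sublist (s' ++ I) := List.sublist_append_left _ _
    by_cases hcB : c ∈ B
    · refine ⟨w, B.erase c, hw.trans hss, hsp, fun x a y h => (hQ x a y h).trans hss, ?_, ?_⟩
      · intro d hd x hx
        by_cases hdc : d = c
        · subst hdc
          have := (hx.trans hw).append hcI'
          simpa using this
        · exact (hR d (fun h => hd (Finset.mem_erase.mpr ⟨hdc, h⟩)) x hx).trans hss
      · have := Finset.card_erase_add_one hcB
        omega
    · refine ⟨w ++ [c], insert c B, hw.append hcI', ?_, ?_, ?_, ?_⟩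
      · intro x hx hxr
        rcases List.infix_concat_iff.mp hx with h | h
        · rcases List.suffix_concat_iff.mp h with rfl | ⟨t, rfl, ht⟩
          · simp
          · rw [List.length_append, List.length_singleton] at hxr
            have h1 : t.Nodup := hsp t ht.isInfix (by omega)
            have h2 : c ∉ t := by
              intro hct
              apply hcw
              obtain ⟨p, rfl⟩ := ht
              have : (p ++ t).length - (r - 1) ≤ p.length := by
                rw [List.length_append]; omega
              rw [List.drop_append_of_le_length this]
              exact List.mem_append_right _ hct
            rw [List.nodup_append]
            refine ⟨h1, by simp, ?_⟩
            rintro a ha b hb rfl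
            rw [List.mem_singleton] at hb
            exact h2 (hb ▸ ha)
        · exact hsp x h hxr
      · intro x a y h
        rcases sublist_append_singleton_iff.mp h with hxy | ⟨l, hl, hlw⟩
        · exact (hQ x a y hxy).trans hss
        · rcases y.eq_nil_or_concat with rfl | ⟨y', d, rfl⟩
          · have h3 : x ++ [a] ++ [a] = l ++ [c] := by simpa using hl
            obtain ⟨rfl, h4⟩ := List.append_inj' h3 rfl
            obtain rfl : a = c := by simpa using h4
            have := (hR a hcB x hlw).append hcI'
            simpa using this
          · have h3 : (x ++ [a, a] ++ y') ++ [d] = l ++ [c] := by simpa using hl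
            obtain ⟨rfl, h4⟩ := List.append_inj' h3 rfl
            obtain rfl : d = c := by simpa using h4
            have := (hQ x a y' hlw).append hcI'
            simpa using this
      · intro d hd x hx
        rw [Finset.mem_insert, not_or] at hd
        rcases sublist_append_singleton_iff.mp hx with h | ⟨l, hl, h⟩
        · exact (hR d hd.2 x h).trans hss
        · have h4 := (List.append_inj' hl rfl).2
          exact absurd (by simpa using h4) hd.1
      · have := Finset.card_insert_of_notMem hcB
        rw [List.length_append, List.length_singleton]
        omega

theorem numLetters_triple {α : Type*} [DecidableEq α] (x y : List α) (a : α) :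
    numLetters (x ++ [a, a, a] ++ y) = numLetters (x ++ [a, a] ++ y) := by
  unfold numLetters
  congr 1
  ext b
  simp

theorem Sparse.infix {α : Type*} {r : ℕ} {s t : List α} (h : Sparse r s) (ht : t <:+: s) :
    Sparse r t := fun w hw hl => h w (hw.trans ht) hl

theorem length_le_Ex {α : Type*} [DecidableEq α] {u : List α} {n : ℕ} {s : List ℕ}
    (hn : numLetters s ≤ n) (hs : Sparse (numLetters u) s) (ha : Avoids s u) :
    s.length ≤ Ex u n :=
  le_csSup (bddAbove_exLengths u n) ⟨s, rfl, hn, hs, ha⟩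

/-- Tripling a doubled letter changes the extremal function only by a constant factor. -/
theorem Ex_triple_le {α : Type*} [DecidableEq α] (x y : List α) (a : α) :
    ∃ L : ℕ, ∀ n, Ex (x ++ [a, a, a] ++ y) n ≤ L * (2 * Ex (x ++ [a, a] ++ y) n + 1) := by
  set u := x ++ [a, a, a] ++ y with hu
  set v := x ++ [a, a] ++ y with hv
  set r := numLetters u with hr
  have hrv : r = numLetters v := numLetters_triple x y a
  have hrpos : 0 < r := by
    rw [hr, numLetters, Finset.card_pos]
    exact ⟨a, by simp [hu]⟩
  -- A block of this length inherits sparsity and avoidance of `u` from `s`, and is too long to live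
  -- on `r - 1` letters.
  refine ⟨Ex u (r - 1) + 1, fun n => ?_⟩
  set L := Ex u (r - 1) + 1 with hL
  have hne : u ≠ [] := by simp [hu]
  obtain ⟨s, hsl, hsn, hss, hsa⟩ := (isGreatest_Ex u hne n).1
  have hblock : ∀ I, I <:+: s → I.length = L → r ≤ I.toFinset.card := by
    intro I hI hIL
    by_contra! hlt
    have h1 : I.length ≤ Ex u (r - 1) := length_le_Ex (Nat.le_sub_one_of_lt hlt) (hss.infix hI)
      fun hc => hsa (hc.of_sublist hI.sublist)
    omega
  obtain ⟨w, B, hw, hsp, hQ, -, hcard⟩ :=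
    exists_separated_aux hrpos s hblock (s.length / L) (Nat.div_mul_le_self _ _)
  have hws : w.Sublist s := hw.trans (List.take_sublist _ _)
  have hwv : Avoids w v := by
    rintro ⟨z, hz, hi⟩
    obtain ⟨x', b, y', hx', rfl⟩ := hi.exists_pair
    exact hsa ⟨_, (hQ x' b y' hz).trans (List.take_sublist _ _), hi.triple hx'⟩
  have hwl : w.length ≤ Ex v n := length_le_Ex ((numLetters_le_of_sublist hws).trans hsn)
    (fun t ht hl => hsp t ht (by rw [hl, hrv])) hwv
  rw [← hsl]
  have h1 := Nat.lt_mul_div_succ s.length (show 0 < L by omega)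
  exact h1.le.trans (Nat.mul_le_mul_left _ (by omega))

theorem MinimallyNonlinear.not_triple_infix {α : Type*} [DecidableEq α] {u : List α}
    (hu : MinimallyNonlinear u) (a : α) : ¬ [a, a, a] <:+: u := by
  rintro ⟨x, y, rfl⟩
  have hv : (fun n : ℕ => (Ex (x ++ [a, a] ++ y) n : ℝ)) =O[atTop] fun n : ℕ => (n : ℝ) := by
    apply hu.2
    · refine ⟨_, ?_, rfl, fun _ _ => Iff.rfl⟩
      exact (((List.sublist_cons_self a [a, a])).append_left x).append_right y
    · intro h
      have := h.1
      simp at this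
  obtain ⟨L, hL⟩ := Ex_triple_le x y a
  have hone : (fun _ : ℕ => (1 : ℝ)) =O[atTop] fun n : ℕ => (n : ℝ) := by
    refine IsBigO.of_bound 1 ?_
    filter_upwards [eventually_ge_atTop 1] with n hn
    have : (1 : ℝ) ≤ n := by exact_mod_cast hn
    simpa using this
  have h1 : (fun n : ℕ => (Ex (x ++ [a, a, a] ++ y) n : ℝ)) =O[atTop] fun n : ℕ => (n : ℝ) := by
    refine IsBigO.trans (IsBigO.of_bound 1 (Eventually.of_forall fun n => ?_))
      (((hv.const_mul_left 2).add hone).const_mul_left (L : ℝ))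
    have : (Ex (x ++ [a, a, a] ++ y) n : ℝ) ≤ L * (2 * Ex (x ++ [a, a] ++ y) n + 1) := by
      exact_mod_cast hL n
    rw [one_mul, Real.norm_of_nonneg (by positivity), Real.norm_of_nonneg (by positivity)]
    exact this
  have h2 := hu.1.trans_isBigO h1
  have h3 := isLittleO_irrefl (f'' := fun n : ℕ => (n : ℝ)) (l := atTop) (by
    apply Eventually.frequently
    filter_upwards [eventually_ge_atTop 1] with n hn
    have : n ≠ 0 := by omega
    exact_mod_cast this)
  exact h3 h2

/-! ### Greedy matching of a pattern -/

/-- One step of greedy matching: the pattern that is still to be matched after reading `x`. -/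
def matchStep (p : List ℕ) (x : ℕ) : List ℕ :=
  match p with
  | [] => []
  | a :: q => if a = x then q else a :: q

/-- The part of the pattern `p` that is left over after matching it greedily along `s`. -/
def residue (p s : List ℕ) : List ℕ := s.foldl matchStep p

@[simp] theorem residue_nil (p : List ℕ) : residue p [] = p := rfl

@[simp] theorem residue_cons (p : List ℕ) (x : ℕ) (s : List ℕ) :
    residue p (x :: s) = residue (matchStep p x) s := rfl

@[simp] theorem residue_append (p s t : List ℕ) :
    residue p (s ++ t) = residue (residue p s) t := List.foldl_append

/-- Greedy matching is optimal. Being a subsequence thus becomes a run of an automaton whose states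
are the suffixes of `p`, so two sequences can be compared piece by piece. -/
theorem residue_eq_nil_iff (p s : List ℕ) : residue p s = [] ↔ p.Sublist s := by
  induction s generalizing p with
  | nil => simp
  | cons x s ih =>
    rw [residue_cons, ih]
    cases p with
    | nil => simp [matchStep]
    | cons a q =>
      by_cases h : a = x
      · subst h; simp [matchStep]
      · simp only [matchStep, if_neg h]
        constructor
        · exact fun h' => h'.cons x
        · intro h'
          cases h' with
          | cons _ h' => exact h'
          | cons_cons _ h' => exact absurd rfl h

theorem matchStep_suffix (p : List ℕ) (x : ℕ) : matchStep p x <:+ p := by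
  cases p with
  | nil => exact List.suffix_rfl
  | cons a q =>
    by_cases h : a = x
    · simp [matchStep, h]
    · simp [matchStep, h]

theorem residue_suffix (p s : List ℕ) : residue p s <:+ p := by
  induction s generalizing p with
  | nil => exact List.suffix_rfl
  | cons x s ih => exact (ih _).trans (matchStep_suffix p x)

theorem residue_of_disjoint {p s : List ℕ} (h : ∀ x ∈ s, x ∉ p) : residue p s = p := by
  induction s with
  | nil => rfl
  | cons x s ih =>
    have hx : matchStep p x = p := by
      cases p with
      | nil => rfl
      | cons a q =>
        have : a ≠ x := fun e => h x (by simp) (by simp [e])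
        simp [matchStep, this]
    rw [residue_cons, hx]
    exact ih fun y hy => h y (List.mem_cons_of_mem _ hy)

/-- Once the head `x` is consumed, the next letter of the pattern differs from it. Immediate
repetitions in a sequence are therefore invisible to such patterns. -/
theorem matchStep_matchStep {p : List ℕ} (hp : p.IsChain (· ≠ ·)) (x : ℕ) :
    matchStep (matchStep p x) x = matchStep p x := by
  rcases p with _ | ⟨a, _ | ⟨b, q⟩⟩
  · rfl
  · by_cases h : a = x <;> simp [matchStep, h]
  · by_cases h : a = x
    · subst h
      have : b ≠ a := by
        rw [List.isChain_cons_cons] at hp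
        exact hp.1.symm
      simp [matchStep, this]
    · simp [matchStep, h]

/-! ### Blocks and the recursive construction -/

/-- A sequence cut into consecutive blocks, some of which are marked as special. -/
abbrev Blocks := List (Bool × List ℕ)

namespace Blocks

/-- The sequence itself. -/
def flat : Blocks → List ℕ
  | [] => []
  | t :: Z => t.2 ++ flat Z

/-- The sequence in which each special block is followed by its reversal. -/
def dbl : Blocks → List ℕ
  | [] => []
  | (true, A) :: Z => A ++ (A.reverse ++ dbl Z)
  | (false, A) :: Z => A ++ dbl Z

/-- The number of special blocks. -/
def special : Blocks → ℕ
  | [] => 0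
  | (true, _) :: Z => special Z + 1
  | (false, _) :: Z => special Z

/-- Append the letters of `A` to the special blocks, one to each. -/
def insertLetters : Blocks → List ℕ → Blocks
  | [], _ => []
  | (false, X) :: Z, A => (false, X) :: insertLetters Z A
  | (true, B) :: Z, [] => (true, B) :: insertLetters Z []
  | (true, B) :: Z, a :: A => (true, B ++ [a]) :: insertLetters Z A

/-- Rename the letters by giving them the tag `i`. -/
def tag (i : ℕ) (Z : Blocks) : Blocks := Z.map fun t => (t.1, t.2.map (Nat.pair i))

/-- Replace the special blocks `A` of `W` by disjoint copies of `Z`, numbered from `j` on, into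
which `A` is inserted and which are followed by the reversal of `A`. -/
def combine (Z : Blocks) : Blocks → ℕ → Blocks
  | [], _ => []
  | (false, Y) :: W, j => (false, Y.map (Nat.pair 0)) :: combine Z W j
  | (true, A) :: W, j =>
    insertLetters (tag (j + 1) Z) (A.map (Nat.pair 0)) ++
      (false, (A.map (Nat.pair 0)).reverse) :: combine Z W (j + 1)

/-- Special blocks consist of distinct letters that have not occurred before. -/
def Fresh (Z : Blocks) : Prop :=
  Z.Pairwise fun t t' => t'.1 = true → t.2.Disjoint t'.2

@[simp] theorem flat_append (Z Z' : Blocks) : flat (Z ++ Z') = flat Z ++ flat Z' := by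
  induction Z with
  | nil => rfl
  | cons t Z ih => simp [flat, ih]

@[simp] theorem special_append (Z Z' : Blocks) : special (Z ++ Z') = special Z + special Z' := by
  induction Z with
  | nil => simp [special]
  | cons t Z ih => obtain ⟨_ | _, A⟩ := t <;> simp [special, ih]; omega

@[simp] theorem dbl_append (Z Z' : Blocks) : dbl (Z ++ Z') = dbl Z ++ dbl Z' := by
  induction Z with
  | nil => rfl
  | cons t Z ih => obtain ⟨_ | _, A⟩ := t <;> simp [dbl, ih]

theorem flat_sublist_dbl (Z : Blocks) : (flat Z).Sublist (dbl Z) := by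
  induction Z with
  | nil => exact List.Sublist.refl _
  | cons t Z ih =>
    obtain ⟨_ | _, A⟩ := t
    · exact ih.append_left A
    · exact (ih.trans (List.sublist_append_right _ _)).append_left A

theorem mem_flat {Z : Blocks} {x : ℕ} : x ∈ flat Z ↔ ∃ t ∈ Z, x ∈ t.2 := by
  induction Z with
  | nil => simp [flat]
  | cons t Z ih => simp [flat, ih]

@[simp] theorem mem_dbl {Z : Blocks} {x : ℕ} : x ∈ dbl Z ↔ x ∈ flat Z := by
  induction Z with
  | nil => simp [dbl, flat]
  | cons t Z ih => obtain ⟨_ | _, A⟩ := t <;> simp [dbl, flat, ih]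

@[simp] theorem flat_tag (i : ℕ) (Z : Blocks) : flat (tag i Z) = (flat Z).map (Nat.pair i) := by
  induction Z with
  | nil => rfl
  | cons t Z ih => simp only [tag, List.map_cons, flat, List.map_append] at *; rw [ih]

@[simp] theorem dbl_tag (i : ℕ) (Z : Blocks) : dbl (tag i Z) = (dbl Z).map (Nat.pair i) := by
  induction Z with
  | nil => rfl
  | cons t Z ih =>
    obtain ⟨_ | _, A⟩ := t <;>
      simp only [tag, List.map_cons, dbl, List.map_append, List.map_reverse] at * <;> rw [ih]

@[simp] theorem special_tag (i : ℕ) (Z : Blocks) : special (tag i Z) = special Z := by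
  induction Z with
  | nil => rfl
  | cons t Z ih =>
    obtain ⟨_ | _, A⟩ := t <;> simp only [tag, List.map_cons, special] at * <;> rw [ih]

@[simp] theorem length_tag (i : ℕ) (Z : Blocks) : (tag i Z).length = Z.length := by simp [tag]

@[simp] theorem special_insertLetters (Z : Blocks) (A : List ℕ) :
    special (insertLetters Z A) = special Z := by
  induction Z generalizing A with
  | nil => rfl
  | cons t Z ih => obtain ⟨_ | _, B⟩ := t <;> cases A <;> simp [special, insertLetters, ih]

@[simp] theorem length_insertLetters (Z : Blocks) (A : List ℕ) :
    (insertLetters Z A).length = Z.length := by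
  induction Z generalizing A with
  | nil => rfl
  | cons t Z ih => obtain ⟨_ | _, B⟩ := t <;> cases A <;> simp [insertLetters, ih]

theorem length_flat_insertLetters (Z : Blocks) (A : List ℕ) (h : A.length = special Z) :
    (flat (insertLetters Z A)).length = (flat Z).length + A.length := by
  induction Z generalizing A with
  | nil => rw [h]; rfl
  | cons t Z ih =>
    obtain ⟨_ | _, B⟩ := t
    · simp [insertLetters, flat, ih A h]; omega
    · cases A with
      | nil => simp [special] at h
      | cons a A =>
        have := ih A (by simpa [special] using h)
        simp [insertLetters, flat, this]; omega

theorem mem_flat_insertLetters {Z : Blocks} {A : List ℕ} {x : ℕ}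
    (h : x ∈ flat (insertLetters Z A)) : x ∈ flat Z ∨ x ∈ A := by
  induction Z generalizing A with
  | nil => simp [insertLetters, flat] at h
  | cons t Z ih =>
    obtain ⟨_ | _, B⟩ := t <;> rcases A with _ | ⟨a, A⟩ <;>
      simp only [insertLetters, flat, List.mem_append, List.mem_cons, List.not_mem_nil,
        or_false] at h ⊢
    · rcases h with h | h
      · tauto
      · have := ih h; simp at this; tauto
    · rcases h with h | h
      · tauto
      · have := ih h; simp at this; tauto
    · rcases h with h | h
      · tauto
      · have := ih h; simp at this; tauto
    · rcases h with (h | h) | h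
      · tauto
      · tauto
      · have := ih h; tauto

/-- Seen from the inserted letters, only these are there, each of them twice. -/
theorem residue_dbl_insertLetters_of_disjoint {p : List ℕ} (hp : p.IsChain (· ≠ ·)) (Z : Blocks)
    (A : List ℕ) (hZ : ∀ x ∈ flat Z, x ∉ p) (h : A.length = special Z) :
    residue p (dbl (insertLetters Z A)) = residue p A := by
  induction Z generalizing A p with
  | nil =>
    obtain rfl : A = [] := by simpa [special] using h
    rfl
  | cons t Z ih =>
    have hd : ∀ x ∈ t.2, x ∉ p := fun x hx => hZ x (by simp [flat, hx])
    have ht : ∀ x ∈ flat Z, x ∉ p := fun x hx => hZ x (by simp [flat, hx])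
    obtain ⟨_ | _, B⟩ := t
    · simp only [insertLetters, dbl, residue_append, residue_of_disjoint hd]
      exact ih hp A ht h
    · cases A with
      | nil => simp [special] at h
      | cons a A =>
        have hs := matchStep_suffix p a
        have hd' : ∀ x ∈ B.reverse, x ∉ matchStep p a :=
          fun x hx hm => hd x (List.mem_reverse.mp hx) (hs.subset hm)
        -- The doubled block reads `B a a B.reverse`; the letters of `B` do nothing and the second
        -- `a` changes nothing.
        simp only [insertLetters, dbl, residue_append, residue_of_disjoint hd, residue_cons,
          residue_nil, List.reverse_append, List.reverse_singleton, matchStep_matchStep hp,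
          residue_of_disjoint hd']
        exact ih (hp.suffix hs) A (fun x hx hm => ht x hx (hs.subset hm))
          (by simpa [special] using h)

/-- Seen from the other letters, the inserted ones are invisible. -/
theorem residue_dbl_insertLetters {p : List ℕ} (Z : Blocks) (A : List ℕ) (hA : ∀ x ∈ A, x ∉ p) :
    residue p (dbl (insertLetters Z A)) = residue p (dbl Z) := by
  induction Z generalizing A p with
  | nil => rfl
  | cons t Z ih =>
    have key : ∀ {A : List ℕ} (s : List ℕ), (∀ x ∈ A, x ∉ p) → ∀ x ∈ A, x ∉ residue p s :=
      fun s hA x hx hm => hA x hx ((residue_suffix p s).subset hm)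
    obtain ⟨_ | _, B⟩ := t
    · simp only [insertLetters, dbl, residue_append]
      exact ih _ (key _ hA)
    · cases A with
      | nil =>
        simp only [insertLetters, dbl, residue_append]
        exact ih _ (by simp)
      | cons a A =>
        have h1 : ∀ x ∈ [a], x ∉ residue p B := key B fun x hx => hA x (by simp [List.mem_singleton.mp hx])
        simp only [insertLetters, dbl, residue_append, List.reverse_append, List.reverse_singleton,
          residue_of_disjoint h1]
        exact ih _ fun x hx hm => hA x (List.mem_cons_of_mem _ hx)
          (((residue_suffix _ _).trans (residue_suffix _ _)).subset hm)

/-- Tag `0` is reserved for the letters of `W`, and copy number `i` of `Z` has tag `i + 1`; all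
later disjointness arguments compare tags. -/
theorem mem_flat_combine {Z W : Blocks} {j x : ℕ} (h : x ∈ flat (combine Z W j)) :
    x ∈ (flat W).map (Nat.pair 0) ∨
      ∃ i, j ≤ i ∧ i < j + special W ∧ x ∈ (flat Z).map (Nat.pair (i + 1)) := by
  induction W generalizing j with
  | nil => simp [combine, flat] at h
  | cons t W ih =>
    obtain ⟨_ | _, A⟩ := t
    · simp only [combine, flat, List.mem_append, List.map_append, special] at h ⊢
      rcases h with h | h
      · exact Or.inl (Or.inl h)
      · rcases ih h with h | h
        · exact Or.inl (Or.inr h)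
        · exact Or.inr h
    · simp only [combine, flat, flat_append, List.mem_append, List.map_append, special,
        List.mem_reverse] at h ⊢
      rcases h with h | h | h
      · rcases mem_flat_insertLetters h with h | h
        · exact Or.inr ⟨j, le_rfl, by omega, by simpa using h⟩
        · exact Or.inl (Or.inl h)
      · exact Or.inl (Or.inl h)
      · rcases ih h with h | ⟨i, h1, h2, h3⟩
        · exact Or.inl (Or.inr h)
        · exact Or.inr ⟨i, by omega, by omega, h3⟩

end Blocks

/-! ### Structure and size of the combined sequence -/

/-- No two letters alternate five times. -/
def AltFree (l : List ℕ) : Prop := ∀ a b, a ≠ b → ¬ [a, b, a, b, a].Sublist l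

theorem AltFree.map {l : List ℕ} (h : AltFree l) {f : ℕ → ℕ} (hf : Function.Injective f) :
    AltFree (l.map f) := by
  intro a b hab hs
  obtain ⟨l', hl', he⟩ := List.sublist_map_iff.mp hs
  obtain ⟨a₁, l₁, rfl, rfl, he⟩ := List.map_eq_cons_iff.mp he.symm
  obtain ⟨b₁, l₂, rfl, rfl, he⟩ := List.map_eq_cons_iff.mp he
  obtain ⟨a₂, l₃, rfl, h1, he⟩ := List.map_eq_cons_iff.mp he
  obtain ⟨b₂, l₄, rfl, h2, he⟩ := List.map_eq_cons_iff.mp he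
  obtain ⟨a₃, l₅, rfl, h3, he⟩ := List.map_eq_cons_iff.mp he
  obtain rfl := List.map_eq_nil_iff.mp he
  obtain rfl := hf h1
  obtain rfl := hf h2
  obtain rfl := hf h3
  exact h _ _ (fun e => hab (by rw [e])) hl'

theorem pair_injective (i : ℕ) : Function.Injective (Nat.pair i) := fun _ _ h =>
  (Nat.pair_eq_pair.mp h).2

theorem tag_of_mem_map {i x : ℕ} {l : List ℕ} (h : x ∈ l.map (Nat.pair i)) : x.unpair.1 = i := by
  obtain ⟨y, -, rfl⟩ := List.mem_map.mp h
  simp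

namespace Blocks

theorem disjoint_map_pair {i j : ℕ} (h : i ≠ j) (l l' : List ℕ) :
    (l.map (Nat.pair i)).Disjoint (l'.map (Nat.pair j)) := fun _ hx hx' =>
  h ((tag_of_mem_map hx).symm.trans (tag_of_mem_map hx'))

theorem mem_insertLetters {Z : Blocks} {A : List ℕ} {t : Bool × List ℕ}
    (h : t ∈ insertLetters Z A) :
    ∃ t' ∈ Z, t'.1 = t.1 ∧ (t.2 = t'.2 ∨ ∃ a ∈ A, t.2 = t'.2 ++ [a]) := by
  induction Z generalizing A with
  | nil => simp [insertLetters] at h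
  | cons t₀ Z ih =>
    have key : ∀ {A' : List ℕ}, A' ⊆ A → t ∈ insertLetters Z A' →
        ∃ t' ∈ t₀ :: Z, t'.1 = t.1 ∧ (t.2 = t'.2 ∨ ∃ a ∈ A, t.2 = t'.2 ++ [a]) := by
      intro A' hA' h
      obtain ⟨t', ht', h1, h2⟩ := ih h
      refine ⟨t', List.mem_cons_of_mem _ ht', h1, h2.imp_right ?_⟩
      rintro ⟨a, ha, h3⟩
      exact ⟨a, hA' ha, h3⟩
    obtain ⟨_ | _, B⟩ := t₀
    · rcases List.mem_cons.mp h with rfl | h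
      · exact ⟨_, List.mem_cons_self, rfl, Or.inl rfl⟩
      · exact key (List.Subset.refl _) h
    · rcases A with _ | ⟨a, A⟩
      · rcases List.mem_cons.mp h with rfl | h
        · exact ⟨_, List.mem_cons_self, rfl, Or.inl rfl⟩
        · exact key (List.Subset.refl _) h
      · rcases List.mem_cons.mp h with rfl | h
        · exact ⟨_, List.mem_cons_self, rfl, Or.inr ⟨a, List.mem_cons_self, rfl⟩⟩
        · exact key (List.subset_cons_self _ _) h

theorem exists_of_special_mem_insertLetters {Z : Blocks} {A B : List ℕ}
    (hA : A.length = special Z) (h : (true, B) ∈ insertLetters Z A) :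
    ∃ B' a, (true, B') ∈ Z ∧ B = B' ++ [a] := by
  induction Z generalizing A with
  | nil => simp [insertLetters] at h
  | cons t Z ih =>
    obtain ⟨_ | _, B₀⟩ := t
    · rcases List.mem_cons.mp h with h | h
      · simp at h
      · obtain ⟨B', a, h1, h2⟩ := ih (A := A) hA h
        exact ⟨B', a, List.mem_cons_of_mem _ h1, h2⟩
    · rcases A with _ | ⟨a, A⟩
      · simp [special] at hA
      · rcases List.mem_cons.mp h with h | h
        · exact ⟨B₀, a, List.mem_cons_self, congrArg Prod.snd h⟩
        · obtain ⟨B', a, h1, h2⟩ := ih (A := A) (by simpa [special] using hA) h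
          exact ⟨B', a, List.mem_cons_of_mem _ h1, h2⟩

theorem fresh_insertLetters {Z : Blocks} (hZ : Fresh Z) {A : List ℕ} (hA : A.Nodup)
    (hd : ∀ x ∈ A, x ∉ flat Z) : Fresh (insertLetters Z A) := by
  induction Z generalizing A with
  | nil => exact List.Pairwise.nil
  | cons t Z ih =>
    obtain ⟨h1, h2⟩ := List.pairwise_cons.mp hZ
    have hZA : ∀ x ∈ A, x ∉ flat Z := fun x hx hm => hd x hx (by simp [flat, hm])
    have key : ∀ {A' : List ℕ}, A' ⊆ A → ∀ t' ∈ insertLetters Z A', t'.1 = true →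
        t.2.Disjoint t'.2 := by
      intro A' hA' t' ht' htt
      obtain ⟨t₁, ht₁, h3, h4⟩ := mem_insertLetters ht'
      have h5 := h1 t₁ ht₁ (h3.trans htt)
      rcases h4 with h4 | ⟨a, ha, h4⟩
      · rwa [h4]
      · rw [h4, List.disjoint_append_right]
        refine ⟨h5, fun x hx hxa => ?_⟩
        obtain rfl := List.mem_singleton.mp hxa
        exact hd x (hA' ha) (by simp [flat, hx])
    obtain ⟨_ | _, B⟩ := t
    · exact List.pairwise_cons.mpr ⟨key (List.Subset.refl _), ih h2 hA hZA⟩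
    · rcases A with _ | ⟨a, A⟩
      · exact List.pairwise_cons.mpr ⟨key (List.Subset.refl _), ih h2 hA hZA⟩
      · obtain ⟨h3, h4⟩ := List.nodup_cons.mp hA
        refine List.pairwise_cons.mpr ⟨fun t' ht' htt => ?_,
          ih h2 h4 fun x hx => hZA x (List.mem_cons_of_mem _ hx)⟩
        refine List.disjoint_append_left.mpr
          ⟨key (List.subset_cons_self _ _) t' ht' htt, fun x hx hxt => ?_⟩
        obtain rfl := List.mem_singleton.mp hx
        rcases mem_flat_insertLetters (mem_flat.mpr ⟨t', ht', hxt⟩) with h | h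
        · exact hZA x List.mem_cons_self h
        · exact h3 h

theorem fresh_tag {Z : Blocks} (hZ : Fresh Z) (i : ℕ) : Fresh (tag i Z) := by
  refine List.pairwise_map.mpr (hZ.imp fun {t t'} h ht => ?_)
  intro x hx hx'
  obtain ⟨y, hy, rfl⟩ := List.mem_map.mp hx
  obtain ⟨y', hy', he⟩ := List.mem_map.mp hx'
  obtain rfl := pair_injective i he
  exact h ht hy hy'

theorem mem_combine {Z W : Blocks} {j : ℕ} {t : Bool × List ℕ} (h : t ∈ combine Z W j) :
    (t.1 = false ∧ ∃ t' ∈ W, t.2 = t'.2.map (Nat.pair 0) ∨ t.2 = (t'.2.map (Nat.pair 0)).reverse) ∨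
      ∃ i A, j ≤ i ∧ (true, A) ∈ W ∧
        t ∈ insertLetters (tag (i + 1) Z) (A.map (Nat.pair 0)) := by
  induction W generalizing j with
  | nil => simp [combine] at h
  | cons t₀ W ih =>
    have key : ∀ {j' : ℕ}, j ≤ j' → t ∈ combine Z W j' →
        (t.1 = false ∧ ∃ t' ∈ t₀ :: W, t.2 = t'.2.map (Nat.pair 0) ∨
          t.2 = (t'.2.map (Nat.pair 0)).reverse) ∨
        ∃ i A, j ≤ i ∧ (true, A) ∈ t₀ :: W ∧
          t ∈ insertLetters (tag (i + 1) Z) (A.map (Nat.pair 0)) := by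
      intro j' hj h
      rcases ih h with ⟨h1, t', ht', h2⟩ | ⟨i, A, h1, h2, h3⟩
      · exact Or.inl ⟨h1, t', List.mem_cons_of_mem _ ht', h2⟩
      · exact Or.inr ⟨i, A, hj.trans h1, List.mem_cons_of_mem _ h2, h3⟩
    obtain ⟨_ | _, A⟩ := t₀
    · rcases List.mem_cons.mp h with rfl | h
      · exact Or.inl ⟨rfl, _, List.mem_cons_self, Or.inl rfl⟩
      · exact key le_rfl h
    · rcases List.mem_append.mp h with h | h
      · exact Or.inr ⟨j, A, le_rfl, List.mem_cons_self, h⟩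
      · rcases List.mem_cons.mp h with rfl | h
        · exact Or.inl ⟨rfl, _, List.mem_cons_self, Or.inr rfl⟩
        · exact key (Nat.le_succ j) h

/-- A special block of the result is a special block of a copy of `Z` plus one letter of some `A`.
The first part is new because copies have distinct tags, the extra letter because `A` was new in
`W`; the reversal of `A` comes later and is not special. -/
theorem fresh_combine {Z W : Blocks} (hZ : Fresh Z) (hW : Fresh W) (hWn : ∀ t ∈ W, t.2.Nodup)
    (j : ℕ) : Fresh (combine Z W j) := by
  induction W generalizing j with
  | nil => exact List.Pairwise.nil
  | cons t W ih =>
    obtain ⟨h1, h2⟩ := List.pairwise_cons.mp hW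
    have key : ∀ {j' : ℕ}, ∀ t' ∈ combine Z W j', t'.1 = true →
        (t.2.map (Nat.pair 0)).Disjoint t'.2 := by
      intro j' t' ht' htt x hx hx'
      rcases mem_combine ht' with ⟨h3, -⟩ | ⟨i, A, -, h3, h4⟩
      · rw [htt] at h3; exact absurd h3 (by simp)
      · rcases mem_flat_insertLetters (mem_flat.mpr ⟨t', h4, hx'⟩) with h | h
        · rw [flat_tag] at h
          exact disjoint_map_pair (Nat.succ_ne_zero i).symm _ _ hx h
        · obtain ⟨y, hy, rfl⟩ := List.mem_map.mp hx
          obtain ⟨y', hy', he⟩ := List.mem_map.mp h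
          obtain rfl := pair_injective 0 he
          exact h1 _ h3 rfl hy hy'
    have ih' := fun j => ih h2 (fun t ht => hWn t (List.mem_cons_of_mem _ ht)) j
    obtain ⟨_ | _, A⟩ := t
    · exact List.pairwise_cons.mpr ⟨key, ih' j⟩
    · refine List.pairwise_append.mpr ⟨?_, List.pairwise_cons.mpr ⟨?_, ih' (j + 1)⟩, ?_⟩
      · refine fresh_insertLetters (fresh_tag hZ _)
          ((hWn _ List.mem_cons_self).map (pair_injective 0)) ?_
        intro x hx hx'
        rw [flat_tag] at hx'
        exact disjoint_map_pair (Nat.succ_ne_zero j).symm _ _ hx hx'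
      · intro t' ht' htt x hx
        exact key t' ht' htt (List.mem_reverse.mp hx)
      · intro t₁ ht₁ t' ht' htt x hx hx'
        rcases List.mem_cons.mp ht' with rfl | ht'
        · simp at htt
        · rcases mem_flat_insertLetters (mem_flat.mpr ⟨t₁, ht₁, hx⟩) with h | h
          · rw [flat_tag] at h
            rcases mem_combine ht' with ⟨h3, -⟩ | ⟨i, A', hi, h3, h4⟩
            · rw [htt] at h3; exact absurd h3 (by simp)
            · rcases mem_flat_insertLetters (mem_flat.mpr ⟨t', h4, hx'⟩) with h' | h'
              · rw [flat_tag] at h'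
                exact disjoint_map_pair (show j + 1 ≠ i + 1 by omega) _ _ h h'
              · exact disjoint_map_pair (Nat.succ_ne_zero j) _ _ h h'
          · exact key t' ht' htt h hx'

theorem nodup_combine {Z W : Blocks} (hZ : ∀ t ∈ Z, t.2.Nodup) (hW : ∀ t ∈ W, t.2.Nodup) (j : ℕ) :
    ∀ t ∈ combine Z W j, t.2.Nodup := by
  intro t ht
  rcases mem_combine ht with ⟨-, t', ht', h | h⟩ | ⟨i, A, -, h1, h2⟩
  · rw [h]; exact (hW t' ht').map (pair_injective 0)
  · rw [h]; exact List.nodup_reverse.mpr ((hW t' ht').map (pair_injective 0))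
  · obtain ⟨t', ht', -, h3⟩ := mem_insertLetters h2
    obtain ⟨t₁, ht₁, rfl⟩ := List.mem_map.mp ht'
    have h4 : (t₁.2.map (Nat.pair (i + 1))).Nodup := (hZ _ ht₁).map (pair_injective _)
    rcases h3 with h3 | ⟨a, ha, h3⟩
    · rw [h3]; exact h4
    · rw [h3, List.nodup_append]
      refine ⟨h4, by simp, ?_⟩
      rintro x hx y hy rfl
      obtain rfl := List.mem_singleton.mp hy
      exact disjoint_map_pair (Nat.succ_ne_zero i) _ _ hx ha

theorem length_special_combine {Z W : Blocks} {m : ℕ}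
    (hZ : ∀ A, (true, A) ∈ Z → A.length = m) (hW : ∀ A, (true, A) ∈ W → A.length = special Z)
    (j : ℕ) : ∀ A, (true, A) ∈ combine Z W j → A.length = m + 1 := by
  intro B hB
  rcases mem_combine hB with ⟨h, -⟩ | ⟨i, A, -, h1, h2⟩
  · simp at h
  · obtain ⟨B', a, h3, rfl⟩ := exists_of_special_mem_insertLetters (by simpa using hW A h1) h2
    obtain ⟨⟨c, B₁⟩, h4, h5⟩ := List.mem_map.mp h3
    obtain ⟨rfl, rfl⟩ := Prod.mk.injEq _ _ _ _ ▸ h5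
    simpa using hZ B₁ h4

theorem special_combine (Z W : Blocks) (j : ℕ) :
    special (combine Z W j) = special W * special Z := by
  induction W generalizing j with
  | nil => simp [combine, special]
  | cons t W ih =>
    obtain ⟨_ | _, A⟩ := t
    · simp [combine, special, ih]
    · simp [combine, special, ih]; ring

theorem length_combine (Z W : Blocks) (j : ℕ) :
    (combine Z W j).length = special W * Z.length + W.length := by
  induction W generalizing j with
  | nil => simp [combine, special]
  | cons t W ih =>
    obtain ⟨_ | _, A⟩ := t
    · simp [combine, special, ih]; ring
    · simp [combine, special, ih]; ring

theorem length_flat_combine (Z W : Blocks) (hW : ∀ A, (true, A) ∈ W → A.length = special Z)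
    (j : ℕ) : (flat (combine Z W j)).length =
      special W * ((flat Z).length + special Z) + (flat W).length := by
  induction W generalizing j with
  | nil => simp [combine, special, flat]
  | cons t W ih =>
    have ih' := fun j => ih (fun A hA => hW A (List.mem_cons_of_mem _ hA)) j
    obtain ⟨_ | _, A⟩ := t
    · simp [combine, special, flat, ih']; ring
    · have hA := hW A List.mem_cons_self
      have := length_flat_insertLetters (tag (j + 1) Z) (A.map (Nat.pair 0)) (by simpa using hA)
      simp [combine, special, flat, ih', this, hA]; ring

theorem card_flat_combine (Z W : Blocks) (j : ℕ) : (flat (combine Z W j)).toFinset.card ≤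
    (flat W).toFinset.card + special W * (flat Z).toFinset.card := by
  have hsub : (flat (combine Z W j)).toFinset ⊆ (flat W).toFinset.image (Nat.pair 0) ∪
      (Finset.Ico j (j + special W) ×ˢ (flat Z).toFinset).image
        fun q => Nat.pair (q.1 + 1) q.2 := by
    intro x hx
    rw [List.mem_toFinset] at hx
    rw [Finset.mem_union, Finset.mem_image, Finset.mem_image]
    rcases mem_flat_combine hx with h | ⟨i, h1, h2, h⟩
    · obtain ⟨y, hy, rfl⟩ := List.mem_map.mp h
      exact Or.inl ⟨y, by simpa using hy, rfl⟩
    · obtain ⟨y, hy, rfl⟩ := List.mem_map.mp h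
      exact Or.inr ⟨(i, y), by simp [h1, h2, hy], rfl⟩
  refine (Finset.card_le_card hsub).trans ((Finset.card_union_le _ _).trans
    (Nat.add_le_add Finset.card_image_le (Finset.card_image_le.trans ?_)))
  simp

/-! ### Alternations in the combined sequence -/

/-- Seen from the letters of `W`, `combine Z W j` looks like `W`. -/
theorem residue_dbl_combine {p : List ℕ} (hp : p.IsChain (· ≠ ·)) (hp0 : ∀ x ∈ p, x.unpair.1 = 0)
    (Z W : Blocks) (hW : ∀ A, (true, A) ∈ W → A.length = special Z) (j : ℕ) :
    residue p (dbl (combine Z W j)) = residue p ((dbl W).map (Nat.pair 0)) := by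
  induction W generalizing j p with
  | nil => rfl
  | cons t W ih =>
    have key : ∀ (s : List ℕ) (j : ℕ), residue (residue p s) (dbl (combine Z W j)) =
        residue (residue p s) ((dbl W).map (Nat.pair 0)) := fun s j =>
      ih (hp.suffix (residue_suffix p s)) (fun x hx => hp0 x ((residue_suffix p s).subset hx))
        (fun A hA => hW A (List.mem_cons_of_mem _ hA)) j
    obtain ⟨_ | _, A⟩ := t
    · simp only [combine, dbl, List.map_append, residue_append]
      exact key _ _
    · have h1 : residue p (dbl (insertLetters (tag (j + 1) Z) (A.map (Nat.pair 0)))) =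
          residue p (A.map (Nat.pair 0)) := by
        refine residue_dbl_insertLetters_of_disjoint hp _ _ ?_
          (by simpa using hW A List.mem_cons_self)
        intro x hx hxp
        rw [flat_tag] at hx
        have h2 := tag_of_mem_map hx
        rw [hp0 x hxp] at h2
        omega
      simp only [combine, dbl, dbl_append, List.map_append, residue_append, h1, List.map_reverse]
      have h2 := key (A.map (Nat.pair 0) ++ (A.map (Nat.pair 0)).reverse) (j + 1)
      simpa only [residue_append] using h2

/-- The part of `combine Z W j` that comes from one copy of `Z`. -/
theorem exists_dbl_combine_eq (Z W : Blocks) (hWf : Fresh W) (hWn : ∀ t ∈ W, t.2.Nodup)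
    (i j : ℕ) : (∀ x ∈ dbl (combine Z W j), x.unpair.1 ≠ i + 1) ∨
      ∃ P A R, dbl (combine Z W j) =
          P ++ (dbl (insertLetters (tag (i + 1) Z) (A.map (Nat.pair 0))) ++ R) ∧
        (true, A) ∈ W ∧ (∀ x ∈ P, x ∉ A.map (Nat.pair 0)) ∧
        (∀ x ∈ P, x.unpair.1 ≠ i + 1) ∧ ∀ x ∈ R, x.unpair.1 ≠ i + 1 := by
  have hlate : ∀ (W : Blocks) (j : ℕ), i < j →
      ∀ x ∈ dbl (combine Z W j), x.unpair.1 ≠ i + 1 := by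
    intro W j hij x hx
    rcases mem_flat_combine (mem_dbl.mp hx) with h | ⟨k, h1, -, h⟩
    · rw [tag_of_mem_map h]; omega
    · rw [tag_of_mem_map h]; omega
  have hzero : ∀ {l : List ℕ}, ∀ x ∈ l.map (Nat.pair 0), x.unpair.1 ≠ i + 1 := by
    intro l x hx
    rw [tag_of_mem_map hx]; omega
  induction W generalizing j with
  | nil => left; simp [combine, dbl]
  | cons t W ih =>
    obtain ⟨h1, h2⟩ := List.pairwise_cons.mp hWf
    have hdisj : ∀ A, (true, A) ∈ W → ∀ x ∈ t.2.map (Nat.pair 0), x ∉ A.map (Nat.pair 0) := by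
      intro A hA x hx hx'
      obtain ⟨y, hy, rfl⟩ := List.mem_map.mp hx
      obtain ⟨y', hy', he⟩ := List.mem_map.mp hx'
      obtain rfl := pair_injective 0 he
      exact h1 _ hA rfl hy hy'
    have ih' := fun j => ih h2 (fun t ht => hWn t (List.mem_cons_of_mem _ ht)) j
    obtain ⟨_ | _, B⟩ := t
    · rcases ih' j with h | ⟨P, A, R, h3, h4, h5, h6, h7⟩
      · left
        intro x hx
        rcases List.mem_append.mp hx with hx | hx
        · exact hzero x hx
        · exact h x hx
      · refine Or.inr ⟨B.map (Nat.pair 0) ++ P, A, R, by simp [combine, dbl, h3],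
          List.mem_cons_of_mem _ h4, ?_, ?_, h7⟩
        · intro x hx
          rcases List.mem_append.mp hx with hx | hx
          · exact hdisj A h4 x hx
          · exact h5 x hx
        · intro x hx
          rcases List.mem_append.mp hx with hx | hx
          · exact hzero x hx
          · exact h6 x hx
    -- Copies are numbered upwards from `j`, so the wanted copy is either the first one, and all
    -- later ones have larger numbers, or the first one belongs to the prefix `P`.
    · by_cases hij : i = j
      · subst hij
        refine Or.inr ⟨[], B, (B.map (Nat.pair 0)).reverse ++ dbl (combine Z W (i + 1)),
          by simp [combine, dbl], List.mem_cons_self, by simp, by simp, ?_⟩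
        intro x hx
        rcases List.mem_append.mp hx with hx | hx
        · exact hzero x (List.mem_reverse.mp hx)
        · exact hlate W _ (Nat.lt_succ_self i) x hx
      · have hQ : ∀ x ∈ dbl (insertLetters (tag (j + 1) Z) (B.map (Nat.pair 0))) ++
            (B.map (Nat.pair 0)).reverse, x.unpair.1 = j + 1 ∨ x ∈ B.map (Nat.pair 0) := by
          intro x hx
          rcases List.mem_append.mp hx with hx | hx
          · rcases mem_flat_insertLetters (mem_dbl.mp hx) with h | h
            · rw [flat_tag] at h
              exact Or.inl (tag_of_mem_map h)
            · exact Or.inr h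
          · exact Or.inr (List.mem_reverse.mp hx)
        have hQi : ∀ x ∈ dbl (insertLetters (tag (j + 1) Z) (B.map (Nat.pair 0))) ++
            (B.map (Nat.pair 0)).reverse, x.unpair.1 ≠ i + 1 := by
          intro x hx
          rcases hQ x hx with h | h
          · omega
          · exact hzero x h
        have heq : dbl (combine Z ((true, B) :: W) j) =
            dbl (insertLetters (tag (j + 1) Z) (B.map (Nat.pair 0))) ++
            (B.map (Nat.pair 0)).reverse ++ dbl (combine Z W (j + 1)) := by
          simp [combine, dbl]
        rcases ih' (j + 1) with h | ⟨P, A, R, h3, h4, h5, h6, h7⟩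
        · left
          intro x hx
          rw [heq] at hx
          rcases List.mem_append.mp hx with hx | hx
          · exact hQi x hx
          · exact h x hx
        · refine Or.inr ⟨_ ++ P, A, R, by rw [heq, h3, List.append_assoc _ P],
            List.mem_cons_of_mem _ h4, ?_, ?_, h7⟩
          · intro x hx hxA
            rcases List.mem_append.mp hx with hx | hx
            · rcases hQ x hx with h | h
              · rw [tag_of_mem_map hxA] at h; omega
              · exact hdisj A h4 x h hxA
            · exact h5 x hx hxA
          · intro x hx
            rcases List.mem_append.mp hx with hx | hx
            · exact hQi x hx
            · exact h6 x hx

/-- Between two occurrences of an inserted letter there is no other one. -/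
theorem not_sublist_dbl_insertLetters {Z : Blocks} {A : List ℕ} (hA : A.Nodup) {a b : ℕ}
    (hab : a ≠ b) (ha : a ∉ flat Z) : ¬ [a, b, a].Sublist (dbl (insertLetters Z A)) := by
  rw [← residue_eq_nil_iff]
  induction Z generalizing A with
  | nil => simp [insertLetters, dbl]
  | cons t Z ih =>
    have hat : ∀ {l : List ℕ}, (∀ x ∈ l, x ∈ t.2) → a ∉ l := fun h hm =>
      ha (by simp [flat, h a hm])
    have haZ : a ∉ flat Z := fun hm => ha (by simp [flat, hm])
    have hskip : ∀ l : List ℕ, (∀ x ∈ l, x ∈ t.2) → residue [a, b, a] l = [a, b, a] := by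
      intro l hl
      have h : a ∉ l := hat hl
      clear hl
      induction l with
      | nil => rfl
      | cons x l ihl =>
        have h1 : a ≠ x := fun e => h (by simp [e])
        simp only [residue_cons, matchStep, if_neg h1]
        exact ihl fun hm => h (by simp [hm])
    obtain ⟨_ | _, B⟩ := t
    · simp only [insertLetters, dbl, residue_append, hskip B fun _ h => h]
      exact ih hA haZ
    · rcases A with _ | ⟨c, A⟩
      · simp only [insertLetters, dbl, residue_append, hskip B fun _ h => h,
          hskip B.reverse fun _ h => List.mem_reverse.mp h]
        exact ih hA haZ
      · obtain ⟨h1, h2⟩ := List.nodup_cons.mp hA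
        -- The doubled block reads `B a a B.reverse`. The first `a` is matched, the second is wasted
        -- because `b` is due, and no `a` comes afterwards.
        by_cases hac : a = c
        · subst hac
          simp only [insertLetters, dbl, residue_append, hskip B fun _ h => h, residue_cons,
            residue_nil, List.reverse_append, List.reverse_singleton, matchStep, if_pos,
            if_neg hab.symm, List.cons_append, List.nil_append]
          rw [← residue_append, residue_eq_nil_iff]
          intro hs
          rcases List.sublist_append_iff.mp hs with ⟨l₁, l₂, he, hl₁, hl₂⟩
          have hmem : a ∈ l₁ ++ l₂ := by rw [← he]; simp
          rcases List.mem_append.mp hmem with h | h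
          · exact hat (fun x hx => List.mem_reverse.mp hx) (hl₁.subset h)
          · rcases mem_flat_insertLetters (mem_dbl.mp (hl₂.subset h)) with h | h
            · exact haZ h
            · exact h1 h
        · simp only [insertLetters, dbl, residue_append, hskip B fun _ h => h, residue_cons,
            residue_nil, List.reverse_append, List.reverse_singleton, matchStep, if_neg hac,
            List.cons_append, List.nil_append, hskip B.reverse fun _ h => List.mem_reverse.mp h]
          exact ih h2 haZ

end Blocks

theorem Sublist.of_append_of_notMem_left {x : ℕ} {l s t : List ℕ} (hx : x ∉ s)
    (h : (x :: l).Sublist (s ++ t)) : (x :: l).Sublist t := by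
  obtain ⟨l₁, l₂, he, h1, h2⟩ := List.sublist_append_iff.mp h
  rcases l₁ with _ | ⟨y, l₁⟩
  · rwa [he]
  · obtain ⟨rfl, -⟩ := List.cons.inj he
    exact absurd (h1.subset List.mem_cons_self) hx

theorem Sublist.of_append_of_notMem_right {x : ℕ} {l s t : List ℕ} (hx : x ∉ t)
    (h : (l ++ [x]).Sublist (s ++ t)) : (l ++ [x]).Sublist s := by
  have h' := h.reverse
  rw [List.reverse_append, List.reverse_append] at h'
  have h2 := Sublist.of_append_of_notMem_left (by simpa using hx) h'
  simpa using h2.reverse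

namespace Blocks

/-- All `b` lie in one copy of `Z`. An `a` between two of them must be a letter inserted there,
hence does not occur before that copy, so `a b a` lies inside it. But the two occurrences of an
inserted letter in a doubled copy are adjacent. -/
theorem not_alternating_combine {Z W : Blocks} (hWf : Fresh W) (hWn : ∀ t ∈ W, t.2.Nodup)
    {i j a b : ℕ} (hb : b.unpair.1 = i + 1) (ha : a.unpair.1 ≠ i + 1) :
    ¬ [a, b, a, b].Sublist (dbl (combine Z W j)) := by
  intro hs
  rcases exists_dbl_combine_eq Z W hWf hWn i j with h | ⟨P, A, R, h1, h2, h3, h4, h5⟩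
  · exact h b (hs.subset (by simp)) hb
  · rw [h1] at hs
    have hbP : b ∉ P := fun h => h4 b h hb
    have hbR : b ∉ R := fun h => h5 b h hb
    have hba : [b, a, b].Sublist (dbl (insertLetters (tag (i + 1) Z) (A.map (Nat.pair 0)))) :=
      Sublist.of_append_of_notMem_right (l := [b, a]) hbR
        (Sublist.of_append_of_notMem_left hbP ((List.sublist_cons_self a _).trans hs))
    have haZ : a ∉ flat (tag (i + 1) Z) := by
      rw [flat_tag]
      exact fun h => ha (tag_of_mem_map h)
    have haA : a ∈ A.map (Nat.pair 0) :=
      (mem_flat_insertLetters (mem_dbl.mp (hba.subset (by simp)))).resolve_left haZ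
    have hab := Sublist.of_append_of_notMem_right (l := [a, b, a]) hbR
      (Sublist.of_append_of_notMem_left (fun h => h3 a h haA) hs)
    exact not_sublist_dbl_insertLetters ((hWn _ h2).map (pair_injective 0))
      (fun e => ha (by rw [e]; exact hb)) haZ ((List.sublist_append_left [a, b, a] [b]).trans hab)

/-- Two letters of `W` alternate as in `dbl W`, because the doubled copy followed by the reversal
looks like `A A.reverse` to them. Two letters of one copy alternate as in `dbl Z`. For different
tags, `ababa` contains both `abab` and `baba`, and one of them ends with a letter from a copy of
`Z`. -/
theorem altFree_dbl_combine {Z W : Blocks} (hZ : AltFree (dbl Z)) (hW : AltFree (dbl W))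
    (hWf : Fresh W) (hWn : ∀ t ∈ W, t.2.Nodup)
    (hWl : ∀ A, (true, A) ∈ W → A.length = special Z) (j : ℕ) :
    AltFree (dbl (combine Z W j)) := by
  intro a b hab hs
  by_cases htag : a.unpair.1 = b.unpair.1
  · rcases Nat.eq_zero_or_eq_succ_pred a.unpair.1 with h0 | h0
    · refine hW.map (pair_injective 0) a b hab ?_
      rw [← residue_eq_nil_iff] at hs ⊢
      refine Eq.trans ?_ hs
      refine (residue_dbl_combine ?_ ?_ Z W hWl j).symm
      · simp [hab, hab.symm]
      · simp [h0, ← htag]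
    · set i := a.unpair.1.pred
      rcases exists_dbl_combine_eq Z W hWf hWn i j with h | ⟨P, A, R, h1, h2, h3, h4, h5⟩
      · exact h a (hs.subset (by simp)) h0
      · refine hZ.map (pair_injective (i + 1)) a b hab ?_
        have hp : ∀ x ∈ [a, b, a, b, a], x.unpair.1 = i + 1 := by
          intro x hx
          have : x = a ∨ x = b := by simp at hx; tauto
          rcases this with rfl | rfl
          · exact h0
          · rw [← htag]; exact h0
        rw [h1] at hs
        have hs' := Sublist.of_append_of_notMem_right (l := [a, b, a, b])
          (fun h => h5 a h h0) (Sublist.of_append_of_notMem_left (fun h => h4 a h h0) hs)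
        have hs'' : [a, b, a, b, a].Sublist
          (dbl (insertLetters (tag (i + 1) Z) (A.map (Nat.pair 0)))) := hs'
        rw [← dbl_tag, ← residue_eq_nil_iff]
        refine Eq.trans ?_ ((residue_eq_nil_iff _ _).mpr hs'')
        refine (residue_dbl_insertLetters _ _ fun x hx hxp => ?_).symm
        have h6 := hp x hxp
        rw [tag_of_mem_map hx] at h6
        omega
  · rcases Nat.eq_zero_or_eq_succ_pred b.unpair.1 with h0 | h0
    · have ha : a.unpair.1 = a.unpair.1.pred + 1 := by
        rcases Nat.eq_zero_or_eq_succ_pred a.unpair.1 with h | h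
        · exact absurd (h.trans h0.symm) htag
        · exact h
      exact not_alternating_combine hWf hWn ha (fun h => htag (ha.trans h.symm))
        ((List.sublist_cons_self a [b, a, b, a]).trans hs)
    · exact not_alternating_combine hWf hWn h0 (fun h => htag (h.trans h0.symm))
        ((List.sublist_append_left [a, b, a, b] [a]).trans hs)

/-! ### The superlinear lower bound for `ababa` -/

/-- The sequences of the lower bound: every letter occurs `d + 1` times on average, the special
blocks have length `m`, and there are few blocks. -/
structure Good (d m : ℕ) (Z : Blocks) : Prop where
  two_le : 2 ≤ special Z
  length_special : ∀ A, (true, A) ∈ Z → A.length = m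
  nodup : ∀ t ∈ Z, t.2.Nodup
  fresh : Fresh Z
  altFree : AltFree (dbl Z)
  length_flat : (flat Z).length = (d + 1) * (special Z * m)
  card_flat : (flat Z).toFinset.card ≤ special Z * m
  length_le : 2 * Z.length ≤ special Z * (2 + d * m)

theorem Good.combine {d m : ℕ} {Z W : Blocks} (hZ : Good (d + 1) m Z)
    (hW : Good d (special Z) W) : Good (d + 1) (m + 1) (combine Z W 0) where
  two_le := by
    rw [special_combine]
    nlinarith [hZ.two_le, hW.two_le]
  length_special := length_special_combine hZ.length_special hW.length_special 0
  nodup := nodup_combine hZ.nodup hW.nodup 0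
  fresh := fresh_combine hZ.fresh hW.fresh hW.nodup 0
  altFree := altFree_dbl_combine hZ.altFree hW.altFree hW.fresh hW.nodup hW.length_special 0
  length_flat := by
    rw [length_flat_combine Z W hW.length_special, special_combine, hZ.length_flat,
      hW.length_flat]
    ring
  card_flat := by
    rw [special_combine]
    calc _ ≤ _ := card_flat_combine Z W 0
      _ ≤ special W * special Z + special W * (special Z * m) :=
        Nat.add_le_add hW.card_flat (Nat.mul_le_mul_left _ hZ.card_flat)
      _ = _ := by ring
  length_le := by
    rw [special_combine, length_combine]
    have h1 := Nat.mul_le_mul_left (special W) hZ.length_le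
    have h2 := hW.length_le
    -- Having at least two special blocks in `Z` lets the term `special W * 2` be absorbed into the
    -- bound for `m + 1`.
    have h3 := Nat.mul_le_mul_left (special W) hZ.two_le
    calc 2 * (special W * Z.length + W.length)
        = special W * (2 * Z.length) + 2 * W.length := by ring
      _ ≤ special W * (special Z * (2 + (d + 1) * m)) + special W * (2 + d * special Z) :=
        Nat.add_le_add h1 h2
      _ = special W * special Z * (2 + (d + 1) * m + d) + special W * 2 := by ring
      _ ≤ special W * special Z * (2 + (d + 1) * m + d) + special W * special Z :=
        Nat.add_le_add_left h3 _
      _ = _ := by ring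

theorem good_zero_right (d : ℕ) : Good d 0 [(true, []), (true, [])] where
  two_le := le_rfl
  length_special := by simp
  nodup := by simp
  fresh := by simp [Fresh]
  altFree := by intro a b _ h; simp [dbl] at h
  length_flat := by simp [flat]
  card_flat := by simp [flat]
  length_le := by simp [special]

theorem good_zero_left (m : ℕ) :
    Good 0 m [(true, List.range m), (true, (List.range m).map (· + m))] where
  two_le := le_rfl
  length_special := by simp
  nodup := by
    simp only [List.mem_cons, List.not_mem_nil, or_false, forall_eq_or_imp, forall_eq]
    exact ⟨List.nodup_range, List.nodup_range.map (add_left_injective m)⟩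
  fresh := by
    simp only [Fresh, List.pairwise_cons, List.mem_cons, List.not_mem_nil, or_false, forall_eq]
    refine ⟨fun _ x hx hx' => ?_, by simp⟩
    simp at hx hx'
    omega
  altFree := by
    intro a b _ hs
    -- The pattern needs `a` three times, but in `dbl` every letter occurs at most twice here.
    have h1 := hs.count_le a
    have h2 : 3 ≤ [a, b, a, b, a].count a := by
      simp only [List.count_cons, List.count_nil, beq_self_eq_true, if_true]
      omega
    have h3 : ((List.range m).map (· + m)).Nodup :=
      List.nodup_range.map (add_left_injective m)
    simp only [dbl, List.append_nil, List.count_append, List.count_reverse, h3.count,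
      List.nodup_range.count, List.mem_range, List.mem_map] at h1
    split_ifs at h1 <;> omega
  length_flat := by simp [flat, special]; ring
  card_flat := by
    refine (List.toFinset_card_le _).trans (le_of_eq ?_)
    simp [flat, special]; ring
  length_le := by simp [special]

/-- A double induction of Ackermann type: the block length required of `W` is the number of special
blocks of `Z`, so the outer hypothesis is needed for all `m` at once. -/
theorem exists_good (d m : ℕ) : ∃ Z, Good d m Z := by
  induction d generalizing m with
  | zero => exact ⟨_, good_zero_left m⟩
  | succ d ihd =>
    induction m with
    | zero => exact ⟨_, good_zero_right _⟩
    | succ m ihm =>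
      obtain ⟨Z, hZ⟩ := ihm
      obtain ⟨W, hW⟩ := ihd (special Z)
      exact ⟨_, hZ.combine hW⟩

/-- Deleting at most one letter from each block removes all repetitions. -/
theorem exists_isChain_sublist (Z : Blocks) (hZ : ∀ t ∈ Z, t.2.Nodup) :
    ∃ s : List ℕ, s.Sublist (flat Z) ∧ s.IsChain (· ≠ ·) ∧
      (flat Z).length ≤ s.length + Z.length := by
  induction Z with
  | nil => exact ⟨[], by simp [flat]⟩
  | cons t Z ih =>
    obtain ⟨s, h1, h2, h3⟩ := ih fun t ht => hZ t (List.mem_cons_of_mem _ ht)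
    have ht := hZ t List.mem_cons_self
    rcases s with _ | ⟨x, s⟩
    · refine ⟨t.2, List.sublist_append_left _ _, List.Pairwise.isChain ht, ?_⟩
      simp only [flat, List.length_append, List.length_cons, List.length_nil] at *
      omega
    · refine ⟨t.2.erase x ++ x :: s, List.erase_sublist.append h1, ?_, ?_⟩
      · refine List.isChain_append.mpr ⟨List.Pairwise.isChain (ht.erase x), h2, ?_⟩
        intro y hy z hz
        obtain rfl : x = z := by simpa using hz
        rintro rfl
        exact ht.not_mem_erase (List.mem_of_getLast? hy)
      · have h4 : t.2.length ≤ (t.2.erase x).length + 1 := by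
          rw [List.length_erase]; split <;> omega
        simp only [flat, List.length_append, List.length_cons] at *
        omega

end Blocks

theorem Iso.exists_eq_ababa {α : Type*} {w : List α} (h : Iso w ababa) :
    ∃ a b, a ≠ b ∧ w = [a, b, a, b, a] := by
  obtain ⟨h1, h2⟩ := h
  match w, h1 with
  | [a, b, c, d, e], _ =>
    have e1 := h2 0 2
    have e2 := h2 0 4
    have e3 := h2 1 3
    have e4 := h2 0 1
    simp [ababa] at e1 e2 e3 e4
    exact ⟨a, b, e4, by simp [← e1, ← e2, ← e3]⟩

theorem numLetters_ababa : numLetters ababa = 2 := by decide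

theorem sparse_two_of_isChain {α : Type*} {s : List α} (h : s.IsChain (· ≠ ·)) :
    Sparse 2 s := by
  intro w hw hl
  obtain ⟨a, b, rfl⟩ := List.length_eq_two.mp hl
  have := h.infix hw
  simpa using this

theorem length_le_Ex_ababa {s : List ℕ} {n : ℕ} (h : s.IsChain (· ≠ ·)) (hn : numLetters s ≤ n)
    (ha : Avoids s ababa) : s.length ≤ Ex ababa n :=
  length_le_Ex hn (by rw [numLetters_ababa]; exact sparse_two_of_isChain h) ha

/-- `Ex(ababa, n)` grows faster than linearly. -/
theorem not_isBigO_Ex_ababa :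
    ¬ (fun n : ℕ => (Ex ababa n : ℝ)) =O[atTop] fun n : ℕ => (n : ℝ) := by
  intro h
  obtain ⟨C, hC⟩ := h.bound
  obtain ⟨N, hN⟩ := eventually_atTop.mp hC
  obtain ⟨d, hd⟩ := exists_nat_gt (2 * C * (N + 1))
  -- With `m = 1` and `F` special blocks, the sequence has length `(d + 1) * F` on at most `F`
  -- letters. Removing repetitions costs at most one letter per block, hence at most `F * (2 + d) /
  -- 2`, which leaves at least `d * F / 2`.
  obtain ⟨Z, hZ⟩ := Blocks.exists_good d 1
  obtain ⟨s, h1, h2, h3⟩ := Blocks.exists_isChain_sublist Z hZ.nodup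
  set F := Z.special with hF
  have hlen : d * F ≤ 2 * s.length := by
    have h4 := hZ.length_flat
    have h5 := hZ.length_le
    rw [← hF] at h4 h5
    nlinarith
  -- Allowing `F + N` letters passes the threshold `N` and costs at most a factor `N + 1`, which the
  -- choice of `d` provides for.
  have hs : s.length ≤ Ex ababa (F + N) := by
    refine length_le_Ex_ababa h2 ?_ ?_
    · have := (numLetters_le_of_sublist h1).trans hZ.card_flat
      omega
    · rintro ⟨w, hw, hi⟩
      obtain ⟨a, b, hab, rfl⟩ := hi.exists_eq_ababa
      exact hZ.altFree a b hab (hw.trans (h1.trans (Blocks.flat_sublist_dbl Z)))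
  have hup := hN (F + N) (Nat.le_add_left _ _)
  rw [Real.norm_of_nonneg (by positivity), Real.norm_of_nonneg (by positivity)] at hup
  have hF2 : (2 : ℝ) ≤ F := by exact_mod_cast hZ.two_le
  have hN0 : (0 : ℝ) ≤ N := by positivity
  have hlen' : (d : ℝ) * F ≤ 2 * s.length := by exact_mod_cast hlen
  have hs' : (s.length : ℝ) ≤ Ex ababa (F + N) := by exact_mod_cast hs
  push_cast at hup
  have hC0 : 0 ≤ C := by
    by_contra! hneg
    have h4 : C * ((F : ℝ) + N) < 0 := mul_neg_of_neg_of_pos hneg (by linarith)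
    have h5 : (0 : ℝ) ≤ Ex ababa (F + N) := by positivity
    linarith
  have h4 : C * ((F : ℝ) + N) ≤ C * ((N + 1) * F) := by
    refine mul_le_mul_of_nonneg_left ?_ hC0
    nlinarith
  have h5 : 2 * C * (N + 1) * F < d * F := mul_lt_mul_of_pos_right hd (by linarith)
  linarith

/-! ### Avoidance of `ababa` and the length bound -/

theorem Avoids.of_sublist {α β : Type*} {s t : List α} {u : List β} (h : Avoids t u)
    (hst : s.Sublist t) : Avoids s u := fun hc => h (hc.of_sublist hst)

theorem Iso.numLetters_ababa {α : Type*} [DecidableEq α] {w : List α} (h : Iso w ababa) :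
    numLetters w = 2 := by
  obtain ⟨a, b, hab, rfl⟩ := h.exists_eq_ababa
  have : [a, b, a, b, a].toFinset = {a, b} := by ext; simp; tauto
  rw [numLetters, this, Finset.card_pair hab]

theorem Ex_eq_of_iso_ababa {α : Type*} [DecidableEq α] {w : List α} (h : Iso w ababa) (n : ℕ) :
    Ex w n = Ex ababa n := by
  have h1 : ∀ s : List ℕ, Avoids s w ↔ Avoids s ababa := fun s =>
    not_congr ⟨fun ⟨t, ht, hi⟩ => ⟨t, ht, hi.trans h⟩, fun ⟨t, ht, hi⟩ => ⟨t, ht, hi.trans h.symm⟩⟩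
  simp only [Ex, exLengths, h.numLetters_ababa, DSSeq.numLetters_ababa, h1]

/-- A minimally non-linear sequence other than `ababa` avoids `ababa`. -/
theorem MinimallyNonlinear.avoids_ababa {α : Type*} [DecidableEq α] {u : List α}
    (hu : MinimallyNonlinear u) (h : ¬ Iso u ababa) : Avoids u ababa := by
  rintro ⟨w, hw, hi⟩
  have := hu.2 w ⟨w, hw, rfl, fun _ _ => Iff.rfl⟩ fun hwu => h (hwu.symm.trans hi)
  simp only [Ex_eq_of_iso_ababa hi] at this
  exact not_isBigO_Ex_ababa this

/-- A sequence without three consecutive equal letters has a subsequence of at least half its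
length without repetitions. -/
theorem exists_isChain_sublist_of_not_triple {α : Type*} : ∀ (u : List α),
    (∀ a, ¬ [a, a, a] <:+: u) →
    ∃ s : List α, s.Sublist u ∧ s.IsChain (· ≠ ·) ∧ s.head? = u.head? ∧ u.length ≤ 2 * s.length
  | [], _ => ⟨[], by simp⟩
  | [a], _ => ⟨[a], by simp⟩
  | a :: b :: u, h => by
    classical
    have hsuf : ∀ {v : List α}, v <:+ a :: b :: u → ∀ c, ¬ [c, c, c] <:+: v := fun hv c hc =>
      h c (hc.trans hv.isInfix)
    by_cases hab : a = b
    · subst hab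
      obtain ⟨s, h1, h2, h3, h4⟩ := exists_isChain_sublist_of_not_triple u
        (hsuf ((List.suffix_cons a u).trans (List.suffix_cons a _)))
      refine ⟨a :: s, (h1.cons a).cons_cons a, List.isChain_cons.mpr ⟨?_, h2⟩, by simp, by
        simp only [List.length_cons]; omega⟩
      rintro y hy rfl
      rw [h3] at hy
      obtain ⟨u', rfl⟩ := List.head?_eq_some_iff.mp hy
      exact h a ⟨[], u', by simp⟩
    · obtain ⟨s, h1, h2, h3, h4⟩ := exists_isChain_sublist_of_not_triple (b :: u)
        (hsuf (List.suffix_cons a _))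
      refine ⟨a :: s, h1.cons_cons a, List.isChain_cons.mpr ⟨?_, h2⟩, by simp, by
        simp only [List.length_cons] at *; omega⟩
      rintro y hy rfl
      rw [h3] at hy
      exact hab (by simpa using hy.symm)

/-- The letters of a sequence can be replaced by natural numbers. -/
theorem exists_nat_map {α : Type*} [DecidableEq α] (s : List α) :
    ∃ f : α → ℕ, Set.InjOn f {x | x ∈ s} :=
  ⟨fun x => s.idxOf x, fun _ hx _ _ h => (List.idxOf_inj hx).mp h⟩

theorem Ex_mono {α : Type*} [DecidableEq α] {u : List α} (hu : u ≠ []) {m n : ℕ} (h : m ≤ n) :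
    Ex u m ≤ Ex u n := by
  obtain ⟨s, hs, h1, h2, h3⟩ := (isGreatest_Ex u hu m).1
  rw [← hs]
  exact length_le_Ex (h1.trans h) h2 h3

/-- `Ex` ranges over sequences of natural numbers, so the letters are renamed injectively; a copy of
`ababa` after the renaming would lift back to `s`. -/
theorem length_le_Ex_ababa_of_isChain {α : Type*} [DecidableEq α] {s : List α}
    (h : s.IsChain (· ≠ ·)) (ha : Avoids s ababa) : s.length ≤ Ex ababa (numLetters s) := by
  obtain ⟨f, hf⟩ := exists_nat_map s
  have h1 : numLetters (s.map f) ≤ numLetters s := by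
    have : (s.map f).toFinset = s.toFinset.image f := by ext; simp
    rw [numLetters, this]
    exact Finset.card_image_le
  rw [← List.length_map f]
  refine length_le_Ex_ababa ?_ h1 ?_
  · rw [List.isChain_map]
    exact h.imp_of_mem_imp fun _ _ hx hy hne e => hne (hf hx hy e)
  · rintro ⟨w, hw, hi⟩
    obtain ⟨w', hw', rfl⟩ := List.sublist_map_iff.mp hw
    refine ha ⟨w', hw', by simpa using hi.1, fun i j => ?_⟩
    rw [← hi.2 i j, List.getElem?_map, List.getElem?_map]
    constructor
    · intro e; rw [e]
    · intro e
      rcases hx : w'[i]? with _ | x <;> rcases hy : w'[j]? with _ | y <;> simp [hx, hy] at e ⊢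
      exact hf (hw'.subset (List.mem_of_getElem? hx)) (hw'.subset (List.mem_of_getElem? hy)) e

theorem three_le_Ex_ababa_two : 3 ≤ Ex ababa 2 := by
  refine length_le_Ex_ababa (s := [0, 1, 0]) (by simp) (by decide) ?_
  rintro ⟨w, hw, hi⟩
  have h1 := hw.length_le
  rw [hi.1] at h1
  simp [ababa] at h1

end DSSeq

theorem mainTheorem10 {α : Type*} [DecidableEq α] (u : List α) (k : ℕ)
    (hu : DSSeq.MinimallyNonlinear u) (hk : DSSeq.numLetters u = k) :
    u.length ≤ 2 * DSSeq.Ex DSSeq.ababa k ∧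
      (∀ a : α, ¬ [a, a, a] <:+: u) ∧
      (¬ DSSeq.Iso u DSSeq.ababa → DSSeq.Avoids u DSSeq.ababa) := by
  refine ⟨?_, hu.not_triple_infix, hu.avoids_ababa⟩
  subst hk
  by_cases hi : DSSeq.Iso u DSSeq.ababa
  · have h1 := DSSeq.three_le_Ex_ababa_two
    have h2 : u.length = 5 := hi.1
    rw [hi.numLetters_ababa]
    omega
  · obtain ⟨s, h1, h2, -, h3⟩ :=
      DSSeq.exists_isChain_sublist_of_not_triple u hu.not_triple_infix
    have h4 := DSSeq.length_le_Ex_ababa_of_isChain h2 ((hu.avoids_ababa hi).of_sublist h1)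
    have h5 : DSSeq.Ex DSSeq.ababa (DSSeq.numLetters s) ≤
        DSSeq.Ex DSSeq.ababa (DSSeq.numLetters u) :=
      DSSeq.Ex_mono (by simp [DSSeq.ababa]) (DSSeq.numLetters_le_of_sublist h1)
    omega
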